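/- Let $H$ be a complex Hilbert space, let $\mathcal M\subseteq B(H)$ be a von Neumann algebra with identity $\mathbf 1$, and let $\mathcal M_1=\{y\in\mathcal M:\|y\|\le 1\}$ be its closed unit ball. An element $x\in\mathcal M_1$ is called a $C^*$-extreme point of $\mathcal M_1$ if, whenever $x=\sum_{i=1}^k t_i^*x_it_i$ with $x_1,\dots,x_k\in\mathcal M_1$ and with invertible elements $t_1,\dots,t_k\in\mathcal M$ satisfying $\sum_{i=1}^k t_i^*t_i=\mathbf 1$, there exist unitaries $u_1,\dots,u_k\in\mathcal M$ such that $x_i=u_i^*xu_i$ for $i=1,\dots,k$. For a central projection $p\in\mathcal M$, regard $p\mathcal M$ as a von Neumann algebra with identity $p$; an element $y\in p\mathcal M$ is an isometry in $p\mathcal M$ if $y^*y=p$, a coisometry in $p\mathcal M$ if $yy^*=p$, and a unitary in $p\mathcal M$ if it is both. Let $x\in\mathcal M_1$. Then $x$ is a $C^*$-extreme point of $\mathcal M_1$ if and only if there exist central projections $p_1,p_2,p_3\in\mathcal M$ such that $p_1+p_2+p_3=\mathbf 1$ and the following hold: (i) either $p_1=0$, or $p_1x$ is a unitary in $p_1\mathcal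 M$; (ii) either $p_2=0$, or $p_2x$ is a non-unitary isometry in $p_2\mathcal M$; and (iii) either $p_3=0$, or $p_3x$ is a non-unitary coisometry in $p_3\mathcal M$. -/

import Mathlib

open scoped BigOperators

section CStarExtreme

variable {A : Type*} [NormedRing A] [StarRing A]

/-- `x = ∑ i, (t i)* (a i) (t i)` is a proper C*-convex combination of the points `a i`:
the coefficients `t i` are invertible in `A` and `∑ i, (t i)* (t i) = 1`. -/
def IsProperCStarConvexCombination {k : ℕ} (x : A) (a t : Fin k → A) : Prop :=
  (∀ i, IsUnit (t i)) ∧ ∑ i, star (t i) * t i = 1 ∧ x = ∑ i, star (t i) * a i * t i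

/-- `x` is a C*-extreme point of the closed unit ball of `A`: `x` lies in the ball, and whenever
`x` is a proper C*-convex combination of finitely many points of the ball, each of these
points is unitarily equivalent to `x` in `A`. -/
def IsCStarExtremePoint (x : A) : Prop :=
  x ∈ Metric.closedBall (0 : A) 1 ∧
    ∀ (k : ℕ) (a t : Fin k → A), (∀ i, a i ∈ Metric.closedBall (0 : A) 1) →
      IsProperCStarConvexCombination x a t →
        ∀ i, ∃ u ∈ unitary A, a i = star u * x * u

end CStarExtreme

section Corners

variable {A : Type*} [Ring A] [StarRing A]

/-- `p` is a central projection of `A`. -/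
def IsCentralProjection (p : A) : Prop :=
  IsStarProjection p ∧ p ∈ Set.center A

/-- For a central projection `p`: `y` belongs to the algebra `pA`, whose identity is `p`, and
is an isometry there. -/
def IsIsometryInCorner (p y : A) : Prop :=
  (∃ a : A, y = p * a) ∧ star y * y = p

/-- For a central projection `p`: `y` belongs to the algebra `pA`, whose identity is `p`, and
is a coisometry there. -/
def IsCoisometryInCorner (p y : A) : Prop :=
  (∃ a : A, y = p * a) ∧ y * star y = p

/-- For a central projection `p`: `y` belongs to the algebra `pA`, whose identity is `p`, and
is a unitary there. -/
def IsUnitaryInCorner (p y : A) : Prop :=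
  (∃ a : A, y = p * a) ∧ star y * y = p ∧ y * star y = p

end Corners

/-! By `exists_corners_iff` the three corners reduce to one central projection `p` with `x`
isometric on `p` and coisometric on `1 - p`.

Sufficiency. Padding a corner by the identity, and taking adjoints, reduces to an isometry `x = ∑
tᵢ* aᵢ tᵢ` in `M`. The positive elements `|aᵢ tᵢ - tᵢ x|² + tᵢ* (1 - aᵢ* aᵢ) tᵢ` sum to `1 - x* x =
0`, so each `aᵢ` is an isometry and `tᵢ` makes it similar to `x`. Similar isometries are unitarily
equivalent inside `M`: in the Wold decompositions, `t` matches the unitary parts and `(t⁻¹)*` the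
wandering subspaces. Polar decomposition turns both into partial isometries, and the second extends
along the shifts. The unitaries of the two corners are then glued.

Necessity. By compactness and Krein–Milman, the contractions `y` in `M` with `y |x| = x` have an
extreme point. It satisfies Kadison's condition `(1 - y y*) M (1 - y* y) = 0`, and `x` is the
midpoint of the contractions `y` and `y (2 |x| - 1)`. With coefficients `1/√2`, C*-extremality makes
`y` unitarily equivalent to `x`. Kadison's condition gives a central projection splitting `y` into
an isometric and a coisometric part, and unitary conjugation carries this to `x`. -/

section PolarDecomposition

/-! ### Polar decomposition of an invertible element between projections. -/

variable {A : Type*} [CStarAlgebra A] [PartialOrder A] [StarOrderedRing A]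

/-- If `T` is invertible and maps the range of the projection `e` onto the range of the
projection `f`, then correcting `T * e` by a positive factor `c` gives a partial isometry with
initial projection `e` and final projection `f`. -/
theorem IsStarProjection.exists_polar {e f T T' : A} (he : IsStarProjection e)
    (hf : IsStarProjection f) (hT : T * T' = 1) (hT' : T' * T = 1)
    (hTe : f * (T * e) = T * e) (hTf : e * (T' * f) = T' * f) :
    ∃ c : A, (∀ b, Commute b (star (T * e) * (T * e)) → Commute b e → Commute b c) ∧
      star (T * e * c) * (T * e * c) = e ∧ T * e * c * star (T * e * c) = f := by
  have hee : e * e = e := he.isIdempotentElem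
  have hff : f * f = f := hf.isIdempotentElem
  have hes : star e = e := he.isSelfAdjoint
  have hfs : star f = f := hf.isSelfAdjoint
  -- Adding `1 - e` makes `|T e|²` invertible, with explicit inverse `k`; the correcting factor is
  -- `√k = d^(-1/2)`.
  set d := star (T * e) * (T * e) + (1 - e) with hd
  set k := T' * f * star (T' * f) + (1 - e) with hk
  have h1 : T * e * (T' * f) = f := by rw [mul_assoc, hTf, ← mul_assoc, hT, one_mul]
  have h1' : star (T' * f) * star (T * e) = f := by rw [← star_mul, h1, hfs]
  have h2 : T' * f * (T * e) = e := by rw [mul_assoc, hTe, ← mul_assoc, hT', one_mul]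
  have h2' : star (T * e) * star (T' * f) = e := by rw [← star_mul, h2, hes]
  have h3 : T * e * e = T * e := by rw [mul_assoc, hee]
  have h5 : e * star (T * e) = star (T * e) := by
    conv_rhs => rw [← h3, star_mul, hes]
  have hdk : d * k = 1 := by
    have e1 : star (T * e) * (T * e) * (T' * f * star (T' * f)) = e := by
      calc _ = star (T * e) * (T * e * (T' * f)) * star (T' * f) := by noncomm_ring
        _ = star (T * e) * star (T' * f) := by
          rw [h1, mul_assoc, star_mul T' f, hfs, ← mul_assoc f f, hff]
        _ = e := h2'
    have e2 : star (T * e) * (T * e) * (1 - e) = 0 := by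
      rw [mul_sub, mul_one, mul_assoc, h3, sub_self]
    have e3 : (1 - e) * (T' * f * star (T' * f)) = 0 := by
      rw [sub_mul, one_mul, ← mul_assoc, hTf, sub_self]
    have e4 : (1 - e) * (1 - e) = 1 - e := by
      rw [sub_mul, mul_sub, mul_sub, hee]; simp
    rw [hd, hk, add_mul, mul_add, mul_add, e1, e2, e3, e4]; simp
  have hds : star d = d := by simp [hd, hes]
  have hks : star k = k := by simp [hk, hes]
  have hkd : k * d = 1 := by simpa [hds, hks] using congr(star $hdk)
  have hk0 : 0 ≤ k :=
    add_nonneg (mul_star_self_nonneg _) he.one_sub.nonneg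
  have hcc : CFC.sqrt k * CFC.sqrt k = k := CFC.sqrt_mul_sqrt_self k
  have hcs : star (CFC.sqrt k) = CFC.sqrt k := (CFC.sqrt_nonneg k).isSelfAdjoint
  have hcomm : ∀ b, Commute b (star (T * e) * (T * e)) → Commute b e →
      Commute b (CFC.sqrt k) := by
    intro b hb hbe
    have hbd : Commute b d := hb.add_right ((Commute.one_right b).sub_right hbe)
    have hbk : Commute b k := by
      change b * k = k * b
      calc b * k = k * (d * b) * k := by rw [← mul_assoc k d, hkd, one_mul]
        _ = k * (b * d) * k := by rw [hbd.eq]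
        _ = k * b * (d * k) := by noncomm_ring
        _ = k * b := by rw [hdk, mul_one]
    exact (Commute.cfcₙ_nnreal hbk.symm NNReal.sqrt).symm
  refine ⟨CFC.sqrt k, hcomm, ?_, ?_⟩
  · have hce : Commute e (CFC.sqrt k) := by
      refine hcomm e ?_ (Commute.refl e)
      change e * _ = _ * e
      rw [mul_assoc _ (T * e) e, h3, ← mul_assoc e, h5]
    have hcd : Commute (star (T * e) * (T * e)) (CFC.sqrt k) := by
      refine hcomm _ (Commute.refl _) ?_
      change _ * e = e * _
      rw [mul_assoc _ (T * e) e, h3, ← mul_assoc e, h5]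
    calc star (T * e * CFC.sqrt k) * (T * e * CFC.sqrt k)
        = CFC.sqrt k * (star (T * e) * (T * e)) * CFC.sqrt k := by
          rw [star_mul, hcs]; noncomm_ring
      _ = star (T * e) * (T * e) * k := by rw [← hcd.eq, mul_assoc, hcc]
      _ = e * d * k := by
          rw [hd, mul_add e, ← mul_assoc e (star _), h5, mul_sub, hee, mul_one, sub_self, add_zero]
      _ = e * (d * k) := mul_assoc _ _ _
      _ = e := by rw [hdk, mul_one]
  · calc T * e * CFC.sqrt k * star (T * e * CFC.sqrt k)
        = T * e * (CFC.sqrt k * CFC.sqrt k) * star (T * e) := by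
          rw [star_mul (T * e), hcs]; noncomm_ring
      _ = (T * e * (T' * f)) * (star (T' * f) * star (T * e)) := by
          rw [hcc, hk, mul_add, mul_sub, mul_one, h3, sub_self, add_zero]; noncomm_ring
      _ = f := by rw [h1, h1', hff]

end PolarDecomposition

/-! ### Strong limits and the bicommutant. -/

section StrongLimits

open Filter Topology

variable {H : Type*} [NormedAddCommGroup H] [InnerProductSpace ℂ H] [CompleteSpace H]

theorem ContinuousLinearMap.exists_tendsto_of_cauchySeq (T : ℕ → H →L[ℂ] H)
    (hT : ∀ h, CauchySeq fun n ↦ T n h) :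
    ∃ S : H →L[ℂ] H, ∀ h, Tendsto (fun n ↦ T n h) atTop (𝓝 (S h)) := by
  choose f hf using fun h ↦ cauchySeq_tendsto_of_complete (hT h)
  exact ⟨continuousLinearMapOfTendsto T (tendsto_pi_nhds.2 hf), hf⟩

namespace VonNeumannAlgebra

theorem mem_of_forall_commute {M : VonNeumannAlgebra H} {a : H →L[ℂ] H}
    (h : ∀ b ∈ M.commutant, Commute b a) : a ∈ M := by
  rw [← commutant_commutant M, mem_commutant_iff]
  exact h

theorem commute_of_mem {M : VonNeumannAlgebra H} {a b : H →L[ℂ] H}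
    (hb : b ∈ M.commutant) (ha : a ∈ M) : Commute b a :=
  (mem_commutant_iff.1 hb a ha).symm

/-- Commutation with each element of the commutant survives a strong limit, and `M` is its own
bicommutant. -/
theorem mem_of_tendsto {M : VonNeumannAlgebra H} {T : ℕ → H →L[ℂ] H} {S : H →L[ℂ] H}
    (hT : ∀ n, T n ∈ M) (hS : ∀ h, Tendsto (fun n ↦ T n h) atTop (𝓝 (S h))) : S ∈ M := by
  refine mem_of_forall_commute fun b hb ↦ ContinuousLinearMap.ext fun h ↦ ?_
  refine tendsto_nhds_unique ((b.continuous.tendsto _).comp (hS h)) ?_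
  exact (hS (b h)).congr fun n ↦ congr($((commute_of_mem hb (hT n)).symm) h)

theorem smul_mem (M : VonNeumannAlgebra H) (c : ℂ) {a : H →L[ℂ] H} (ha : a ∈ M) : c • a ∈ M :=
  M.toStarSubalgebra.smul_mem ha c

end VonNeumannAlgebra

theorem mul_eq_zero_of_star_mul_self_eq_one_sub {A : Type*} [NonUnitalNormedRing A] [StarRing A]
    [CStarRing A] {v e x : A} (hv : star v * v = e) (he : e * x = 0) : v * x = 0 := by
  rw [← CStarRing.star_mul_self_eq_zero_iff, star_mul, mul_assoc, ← mul_assoc (star v), hv, he,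
    mul_zero]

theorem isStarProjection_one_sub_mul_star {A : Type*} [Ring A] [StarRing A] {x : A}
    (hx : star x * x = 1) : IsStarProjection (1 - x * star x) := by
  refine IsStarProjection.one_sub ⟨?_, by simp [IsSelfAdjoint]⟩
  change x * star x * (x * star x) = _
  rw [mul_assoc, ← mul_assoc (star x), hx, one_mul]

end StrongLimits

/-! ### Wold decomposition of isometries. -/

section Wold

open Filter Topology

variable {H : Type*} [NormedAddCommGroup H] [InnerProductSpace ℂ H] [CompleteSpace H]

/-- The partial sums `∑ n < N, y ^ n * v * star x ^ n`. -/
noncomputable def shiftSum (x y v : H →L[ℂ] H) : ℕ → H →L[ℂ] H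
  | 0 => 0
  | n + 1 => v + y * shiftSum x y v n * star x

variable {x y v : H →L[ℂ] H}

theorem star_shiftSum (x y v : H →L[ℂ] H) (n : ℕ) :
    star (shiftSum x y v n) = shiftSum y x (star v) n := by
  induction n with
  | zero => simp [shiftSum]
  | succ n ih => simp [shiftSum, ih, mul_assoc]

theorem shiftSum_mem {M : VonNeumannAlgebra H} (hx : x ∈ M) (hy : y ∈ M) (hv : v ∈ M) (n : ℕ) :
    shiftSum x y v n ∈ M := by
  induction n with
  | zero => exact zero_mem M
  | succ n ih => exact add_mem hv (mul_mem (mul_mem hy ih) (star_mem hx))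

theorem shiftSum_add (x y v : H →L[ℂ] H) (m k : ℕ) :
    shiftSum x y v (m + k) = shiftSum x y v m + y ^ m * shiftSum x y v k * star x ^ m := by
  induction m with
  | zero => simp [shiftSum]
  | succ m ih =>
    rw [add_right_comm, shiftSum, shiftSum, ih, pow_succ' y, pow_succ (star x)]
    noncomm_ring

theorem shiftSum_mul (hx : star x * x = 1) (hv : star v * v = 1 - x * star x) (n : ℕ) :
    shiftSum x y v (n + 1) * x = y * shiftSum x y v n := by
  have hvx : v * x = 0 := mul_eq_zero_of_star_mul_self_eq_one_sub hv
    (by rw [sub_mul, mul_assoc, hx]; simp)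
  rw [shiftSum, add_mul, hvx, mul_assoc, hx]; simp

/-- The range of `v` is orthogonal to that of `y`, so cross terms vanish and the initial projections
`x ^ n (1 - x x*) x* ^ n` telescope. -/
theorem star_shiftSum_mul_shiftSum (hy : star y * y = 1)
    (hv : star v * v = 1 - x * star x) (hv' : v * star v = 1 - y * star y) (n : ℕ) :
    star (shiftSum x y v n) * shiftSum x y v n = 1 - x ^ n * star x ^ n := by
  have hvy : star v * y = 0 := by
    refine mul_eq_zero_of_star_mul_self_eq_one_sub (e := 1 - y * star y) (by simpa using hv') ?_
    rw [sub_mul, mul_assoc, hy]; simp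
  have hyv : star y * v = 0 := by simpa using congr(star $hvy)
  induction n with
  | zero => simp [shiftSum]
  | succ n ih =>
    rw [shiftSum]
    set s := shiftSum x y v n
    calc _ = star v * v + (star v * y) * s * star x + x * star s * (star y * v)
          + x * (star s * (star y * y) * s) * star x := by
            simp only [star_add, star_mul, star_star]; noncomm_ring
      _ = _ := by
        rw [hv, hvy, hyv, hy, mul_one, ih, pow_succ' x, pow_succ (star x)]; noncomm_ring

theorem norm_sq_shiftSum_apply (hy : star y * y = 1)
    (hv : star v * v = 1 - x * star x) (hv' : v * star v = 1 - y * star y) (n : ℕ) (h : H) :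
    ‖shiftSum x y v n h‖ ^ 2 = ‖h‖ ^ 2 - ‖(star x ^ n) h‖ ^ 2 := by
  have key : ∀ T : H →L[ℂ] H, ∀ k, ‖T k‖ ^ 2 = RCLike.re (inner ℂ ((star T * T) k) k) := by
    intro T k
    simp [ContinuousLinearMap.star_eq_adjoint, ContinuousLinearMap.adjoint_inner_left,
      ← inner_self_eq_norm_sq (𝕜 := ℂ)]
  rw [key, star_shiftSum_mul_shiftSum hy hv hv', key (star x ^ n)]
  simp [← star_pow, ← inner_self_eq_norm_sq (𝕜 := ℂ)]

theorem star_mul_self_eq_one_iff_norm (x : H →L[ℂ] H) :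
    star x * x = 1 ↔ ∀ h, ‖x h‖ = ‖h‖ := by
  rw [ContinuousLinearMap.star_eq_adjoint]
  exact (ContinuousLinearMap.norm_map_iff_adjoint_comp_self x).symm

/-- The squared increments applied to `h` are differences of the decreasing sequence `‖x* ^ n h‖²`,
which is Cauchy. -/
theorem exists_tendsto_shiftSum (hy : star y * y = 1)
    (hv : star v * v = 1 - x * star x) (hv' : v * star v = 1 - y * star y) :
    ∃ S : H →L[ℂ] H, ∀ h, Tendsto (fun n ↦ shiftSum x y v n h) atTop (𝓝 (S h)) := by
  refine ContinuousLinearMap.exists_tendsto_of_cauchySeq _ fun h ↦ ?_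
  have hyn : ∀ n k, ‖(y ^ n) k‖ = ‖k‖ := by
    intro n
    induction n with
    | zero => simp
    | succ n ih => exact fun k ↦ by rw [pow_succ, mul_apply_eq_comp, ih, (star_mul_self_eq_one_iff_norm y).1 hy]
  have hsq : ∀ m k, ‖shiftSum x y v (m + k) h - shiftSum x y v m h‖ ^ 2
      = ‖(star x ^ m) h‖ ^ 2 - ‖(star x ^ (m + k)) h‖ ^ 2 := by
    intro m k
    rw [shiftSum_add, add_apply, add_sub_cancel_left, add_comm m k, pow_add]
    simp only [mul_apply_eq_comp]
    rw [hyn, norm_sq_shiftSum_apply hy hv hv']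
  have hanti : Antitone fun n ↦ ‖(star x ^ n) h‖ ^ 2 := by
    intro m n hmn
    obtain ⟨k, rfl⟩ := Nat.exists_eq_add_of_le hmn
    have := hsq m k
    dsimp only
    nlinarith [sq_nonneg ‖shiftSum x y v (m + k) h - shiftSum x y v m h‖]
  have hc : CauchySeq fun n ↦ ‖(star x ^ n) h‖ ^ 2 :=
    (tendsto_atTop_ciInf hanti ⟨0, by rintro _ ⟨n, rfl⟩; positivity⟩).cauchySeq
  rw [Metric.cauchySeq_iff'] at hc ⊢
  intro ε hε
  obtain ⟨N, hN⟩ := hc (ε ^ 2) (by positivity)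
  refine ⟨N, fun n hn ↦ ?_⟩
  obtain ⟨k, rfl⟩ := Nat.exists_eq_add_of_le hn
  have h1 := hN _ hn
  rw [Real.dist_eq, abs_sub_comm] at h1
  rw [dist_eq_norm]
  refine lt_of_pow_lt_pow_left₀ 2 hε.le ?_
  rw [hsq]
  exact (le_abs_self _).trans_lt h1

/-- The projection onto the unitary part of an isometry. -/
theorem exists_isStarProjection_tendsto_pow (hx : star x * x = 1) :
    ∃ q : H →L[ℂ] H, IsStarProjection q ∧ q * x = x * q ∧ x * star x * q = q ∧
      (∀ n, x ^ n * star x ^ n * q = q) ∧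
      ∀ h, Tendsto (fun n ↦ (x ^ n * star x ^ n) h) atTop (𝓝 (q h)) := by
  have hpx := isStarProjection_one_sub_mul_star hx
  have hss := hpx.isSelfAdjoint.star_eq
  have hii : (1 - x * star x) * (1 - x * star x) = 1 - x * star x := hpx.isIdempotentElem
  -- With `y = x` and `v` the wandering projection, the partial sums telescope, so their convergence
  -- yields that of `x ^ n x* ^ n`.
  have hsum : ∀ n, shiftSum x x (1 - x * star x) n = 1 - x ^ n * star x ^ n := by
    intro n
    induction n with
    | zero => simp [shiftSum]
    | succ n ih => rw [shiftSum, ih, pow_succ' x, pow_succ (star x)]; noncomm_ring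
  obtain ⟨S, hS⟩ := exists_tendsto_shiftSum hx (x := x) (v := 1 - x * star x)
    (by rw [hss, hii]) (by rw [hss, hii])
  have hq : ∀ h, Tendsto (fun n ↦ (x ^ n * star x ^ n) h) atTop (𝓝 ((1 - S) h)) := by
    intro h
    refine ((tendsto_const_nhds (x := h)).sub (hS h)).congr fun n ↦ ?_
    simp [hsum]
  have hpow : ∀ n, star x ^ n * x ^ n = 1 := by
    intro n
    induction n with
    | zero => simp
    | succ n ih =>
      rw [pow_succ, pow_succ', mul_assoc, ← mul_assoc (star x), hx, one_mul, ih]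
  have hfix : ∀ n, x ^ n * star x ^ n * (1 - S) = 1 - S := by
    intro n
    refine ContinuousLinearMap.ext fun h ↦ ?_
    refine tendsto_nhds_unique (((x ^ n * star x ^ n).continuous.tendsto _).comp (hq h)) ?_
    refine (hq h).congr' ?_
    filter_upwards [eventually_ge_atTop n] with m hm
    obtain ⟨k, rfl⟩ := Nat.exists_eq_add_of_le hm
    change _ = (x ^ n * star x ^ n * (x ^ (n + k) * star x ^ (n + k))) h
    congr 1
    rw [pow_add x, mul_assoc (x ^ n) (star x ^ n), ← mul_assoc (star x ^ n), ← mul_assoc (star x ^ n),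
      hpow, one_mul, mul_assoc]
  refine ⟨1 - S, ⟨?_, ?_⟩, ?_, ?_, hfix, hq⟩
  · refine ContinuousLinearMap.ext fun h ↦ ?_
    refine tendsto_nhds_unique (hq ((1 - S) h)) ?_
    simp_rw [← mul_apply_eq_comp, hfix]
    exact tendsto_const_nhds
  · rw [ContinuousLinearMap.isSelfAdjoint_iff_isSymmetric]
    intro h g
    refine tendsto_nhds_unique (Filter.Tendsto.inner (hq h) tendsto_const_nhds) ?_
    refine (Filter.Tendsto.inner tendsto_const_nhds (hq g)).congr fun n ↦ ?_
    rw [← ContinuousLinearMap.adjoint_inner_left, ← ContinuousLinearMap.star_eq_adjoint]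
    simp
  · refine ContinuousLinearMap.ext fun h ↦ ?_
    refine tendsto_nhds_unique ((tendsto_add_atTop_iff_nat 1).2 (hq (x h))) ?_
    refine ((x.continuous.tendsto _).comp (hq h)).congr fun n ↦ ?_
    change (x * (x ^ n * star x ^ n)) h = (x ^ (n + 1) * star x ^ (n + 1) * x) h
    rw [pow_succ' x, pow_succ (star x), mul_assoc _ _ x, mul_assoc _ _ x, hx, mul_one, mul_assoc]
  · simpa using hfix 1

/-- The limit sends `x ^ n w` to `y ^ n v w` for `w` in the wandering subspace `ker x*`, matching
the two shift parts. -/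
theorem exists_shift_intertwiner (hx : star x * x = 1) (hy : star y * y = 1)
    (hv : star v * v = 1 - x * star x) (hv' : v * star v = 1 - y * star y) {q r : H →L[ℂ] H}
    (hq : ∀ h, Tendsto (fun n ↦ (x ^ n * star x ^ n) h) atTop (𝓝 (q h)))
    (hr : ∀ h, Tendsto (fun n ↦ (y ^ n * star y ^ n) h) atTop (𝓝 (r h))) :
    ∃ S : H →L[ℂ] H, S * x = y * S ∧ star S * S = 1 - q ∧ S * star S = 1 - r ∧
      ∀ h, Tendsto (fun n ↦ shiftSum x y v n h) atTop (𝓝 (S h)) := by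
  obtain ⟨S, hS⟩ := exists_tendsto_shiftSum hy hv hv'
  -- Adjoints do not pass to strong limits in general; here the adjoint sums converge too, being the
  -- same construction with `x` and `y` exchanged.
  obtain ⟨S', hS'⟩ := exists_tendsto_shiftSum (v := star v) hx (by simpa using hv')
    (by simpa using hv)
  have hSS' : star S = S' := by
    refine ContinuousLinearMap.ext fun h ↦ ext_inner_right ℂ fun g ↦ ?_
    rw [ContinuousLinearMap.star_eq_adjoint, ContinuousLinearMap.adjoint_inner_left]
    refine tendsto_nhds_unique (Filter.Tendsto.inner tendsto_const_nhds (hS g)) ?_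
    refine (Filter.Tendsto.inner (hS' h) tendsto_const_nhds).congr fun n ↦ ?_
    rw [← star_shiftSum, ContinuousLinearMap.star_eq_adjoint,
      ContinuousLinearMap.adjoint_inner_left]
  have key : ∀ {x y v q S : H →L[ℂ] H}, star y * y = 1 →
      star v * v = 1 - x * star x → v * star v = 1 - y * star y →
      (∀ h, Tendsto (fun n ↦ (x ^ n * star x ^ n) h) atTop (𝓝 (q h))) →
      (∀ h, Tendsto (fun n ↦ shiftSum x y v n h) atTop (𝓝 (S h))) → star S * S = 1 - q := by
    intro x y v q S hy hv hv' hq hS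
    refine ContinuousLinearMap.ext fun h ↦ ext_inner_right ℂ fun g ↦ ?_
    rw [ContinuousLinearMap.star_eq_adjoint, mul_apply_eq_comp,
      ContinuousLinearMap.adjoint_inner_left]
    refine tendsto_nhds_unique (Filter.Tendsto.inner (hS h) (hS g)) ?_
    refine (Filter.Tendsto.inner ((tendsto_const_nhds (x := h)).sub (hq h))
      (tendsto_const_nhds (x := g))).congr fun n ↦ ?_
    rw [← ContinuousLinearMap.adjoint_inner_left, ← ContinuousLinearMap.star_eq_adjoint,
      ← mul_apply_eq_comp, star_shiftSum_mul_shiftSum hy hv hv']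
    simp
  refine ⟨S, ?_, key hy hv hv' hq hS, ?_, hS⟩
  · refine ContinuousLinearMap.ext fun h ↦ ?_
    refine tendsto_nhds_unique ((tendsto_add_atTop_iff_nat 1).2 (hS (x h))) ?_
    refine ((y.continuous.tendsto _).comp (hS h)).congr fun n ↦ ?_
    exact congr($((shiftSum_mul hx hv n).symm) h)
  · rw [← key hx (v := star v) (by simpa using hv') (by simpa using hv) hr hS', ← hSS',
      star_star]

end Wold

/-! ### From similarity to unitary equivalence. -/

section SimilarIsometries

variable {H : Type*} [NormedAddCommGroup H] [InnerProductSpace ℂ H] [CompleteSpace H]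

open Filter Topology VonNeumannAlgebra

/-- Similar isometries of a von Neumann algebra are unitarily equivalent. -/
theorem VonNeumannAlgebra.exists_unitary_of_similar_isometries (M : VonNeumannAlgebra H)
    {x y t t' : H →L[ℂ] H} (hxM : x ∈ M) (hyM : y ∈ M) (htM : t ∈ M)
    (hx : star x * x = 1) (hy : star y * y = 1) (htt' : t * t' = 1)
    (ht't : t' * t = 1) (hyt : y * t = t * x) :
    ∃ u ∈ M, star u * u = 1 ∧ u * star u = 1 ∧ y * u = u * x := by
  have hsub : ∀ {T e c : H →L[ℂ] H}, T ∈ M → e ∈ M →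
      (∀ b, Commute b (star (T * e) * (T * e)) → Commute b e → Commute b c) →
      T * e * c ∈ M := fun hT he hc ↦
    mul_mem (mul_mem hT he) <| mem_of_forall_commute fun b hb ↦
      hc b (commute_of_mem hb (mul_mem (star_mem (mul_mem hT he)) (mul_mem hT he)))
        (commute_of_mem hb he)
  have hpM : ∀ {x : H →L[ℂ] H}, x ∈ M → 1 - x * star x ∈ M := fun h ↦
    sub_mem (one_mem M) (mul_mem h (star_mem h))
  have hsxt : star x * star t = star t * star y := by simpa using congr(star $(hyt.symm))
  have hxt' : t' * y = x * t' := by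
    calc t' * y = t' * (y * t) * t' := by rw [mul_assoc, mul_assoc, htt', mul_one]
      _ = x * t' := by rw [hyt, ← mul_assoc, ht't, one_mul]
  -- Since `ker x*` is an orthogonal complement, it is the inverse adjoint of `t`, not `t` itself,
  -- that carries it to `ker y*`.
  have hsyt' : star y * star t' = star t' * star x := by simpa using congr(star $hxt')
  have hst : star t' * star t = 1 := by rw [← star_mul, htt', star_one]
  have hst' : star t * star t' = 1 := by rw [← star_mul, ht't, star_one]
  have hcompl : ∀ {x T : H →L[ℂ] H}, star x * T = 0 → (1 - x * star x) * T = T := by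
    intro x T h
    rw [sub_mul, mul_assoc, h]; simp
  -- the wandering subspaces
  obtain ⟨c, hc, hv, hv'⟩ := (isStarProjection_one_sub_mul_star hx).exists_polar
    (isStarProjection_one_sub_mul_star hy) hst hst'
    (hcompl (by
      rw [← mul_assoc, hsyt', mul_assoc, mul_sub, ← mul_assoc (star x) x, hx]; simp))
    (hcompl (by
      rw [← mul_assoc, hsxt, mul_assoc, mul_sub, ← mul_assoc (star y) y, hy]; simp))
  have ht'M : t' ∈ M := mem_of_forall_commute fun b hb ↦ by
    have h := commute_of_mem hb htM
    change b * t' = t' * b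
    calc b * t' = t' * (t * b) * t' := by rw [← mul_assoc t', ht't, one_mul]
      _ = t' * b * (t * t') := by rw [← h.eq]; noncomm_ring
      _ = t' * b := by rw [htt', mul_one]
  have hvM := hsub (star_mem ht'M) (hpM hxM) hc
  set v := star t' * (1 - x * star x) * c
  -- the unitary parts
  obtain ⟨q, hq, hqx, hxq, hPq, hqlim⟩ := exists_isStarProjection_tendsto_pow hx
  obtain ⟨r, hr, hry, hyr, hPr, hrlim⟩ := exists_isStarProjection_tendsto_pow hy
  obtain ⟨S, hSx, hSS, hSS', hSlim⟩ := exists_shift_intertwiner hx hy hv hv' hqlim hrlim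
  have hSM : S ∈ M := mem_of_tendsto (shiftSum_mem hxM hyM hvM) hSlim
  have hqM : q ∈ M :=
    mem_of_tendsto (fun n ↦ mul_mem (pow_mem hxM n) (pow_mem (star_mem hxM) n)) hqlim
  -- As `t x ^ n = y ^ n t`, the intertwiner maps the intersection of the ranges of the `x ^ n` into
  -- that for `y`.
  have hrange : ∀ {x y t q r : H →L[ℂ] H}, star y * y = 1 → y * t = t * x →
      (∀ n, x ^ n * star x ^ n * q = q) →
      (∀ h, Tendsto (fun n ↦ (y ^ n * star y ^ n) h) atTop (𝓝 (r h))) → r * (t * q) = t * q := by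
    intro x y t q r hy hyt hPq hr
    refine ContinuousLinearMap.ext fun h ↦ tendsto_nhds_unique (hr ((t * q) h)) ?_
    refine tendsto_const_nhds.congr fun n ↦ ?_
    change (t * q) h = (y ^ n * star y ^ n * (t * q)) h
    congr 1
    have hpow : star y ^ n * y ^ n = 1 := by
      induction n with
      | zero => simp
      | succ n ih => rw [pow_succ, pow_succ', mul_assoc, ← mul_assoc (star y), hy, one_mul, ih]
    have hyn : y ^ n * t = t * x ^ n := (SemiconjBy.pow_right (a := t) hyt.symm n).symm
    calc t * q = t * x ^ n * star x ^ n * q := by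
          rw [mul_assoc t, mul_assoc t, hPq]
      _ = y ^ n * (star y ^ n * y ^ n) * t * star x ^ n * q := by rw [hpow, mul_one, hyn]
      _ = y ^ n * star y ^ n * (t * x ^ n * star x ^ n * q) := by
        rw [← hyn]; noncomm_ring
      _ = _ := by rw [mul_assoc t, mul_assoc t, hPq]
  have hrtq := hrange hy hyt hPq hrlim
  obtain ⟨d, hd, hw, hw'⟩ := hq.exists_polar hr htt' ht't hrtq (hrange hx hxt'.symm hPr hqlim)
  have hwM := hsub htM hqM hd
  have hqq : q * q = q := hq.isIdempotentElem
  have hqs : star q = q := hq.isSelfAdjoint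
  have hrr : r * r = r := hr.isIdempotentElem
  have hrs : star r = r := hr.isSelfAdjoint
  have hqd : Commute q d := by
    refine hd q ?_ (Commute.refl q)
    change q * _ = _ * q
    rw [star_mul, hqs, mul_assoc q, ← mul_assoc q q, hqq]
    simp only [mul_assoc, hqq]
  have hqx' : star x * q = q * star x := by simpa [hqs] using congr(star $hqx)
  -- `x* (t* t) x = t* y* y t = t* t`, and `x` is unitary on the range of `q`; so `x` commutes with
  -- `|t q|²`.
  have hxd : Commute x d := by
    refine hd x ?_ hqx.symm
    have h1 : star x * (star t * t) * x = star t * t := by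
      calc _ = (star x * star t) * (t * x) := by noncomm_ring
        _ = star t * (star y * y) * t := by rw [hsxt, ← hyt]; noncomm_ring
        _ = _ := by rw [hy, mul_one]
    change x * _ = _ * x
    rw [star_mul, hqs]
    calc x * (q * star t * (t * q)) = x * (q * (star x * (star t * t) * x) * q) := by
          rw [h1]; noncomm_ring
      _ = x * (q * star x * (star t * t) * (x * q)) := by noncomm_ring
      _ = x * star x * q * (star t * t) * (q * x) := by
          rw [← hqx, ← hqx']; noncomm_ring
      _ = _ := by rw [hxq]; noncomm_ring
  have hwx : y * (t * q * d) = t * q * d * x := by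
    calc y * (t * q * d) = (y * t) * q * d := by noncomm_ring
      _ = t * (x * q) * d := by rw [hyt]; noncomm_ring
      _ = t * q * (x * d) := by rw [← hqx]; noncomm_ring
      _ = _ := by rw [hxd.eq]; noncomm_ring
  have hwq : t * q * d * q = t * q * d := by
    rw [mul_assoc, ← hqd.eq, mul_assoc t, ← mul_assoc q, hqq, mul_assoc]
  have hrw : r * (t * q * d) = t * q * d := by rw [← mul_assoc, hrtq]
  set w := t * q * d
  have hSq : S * q = 0 :=
    mul_eq_zero_of_star_mul_self_eq_one_sub hSS (by rw [sub_mul, hqq]; simp)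
  have hSr : star S * r = 0 :=
    mul_eq_zero_of_star_mul_self_eq_one_sub (e := 1 - r) (by simpa using hSS')
      (by rw [sub_mul, hrr]; simp)
  have hSw : star S * w = 0 := by rw [← hrw, ← mul_assoc, hSr, zero_mul]
  have hSw' : star w * S = 0 := by simpa using congr(star $hSw)
  have hwS : S * star w = 0 := by rw [← hwq, star_mul, hqs, ← mul_assoc, hSq, zero_mul]
  have hwS' : w * star S = 0 := by simpa using congr(star $hwS)
  refine ⟨w + S, add_mem hwM hSM, ?_, ?_, ?_⟩
  · rw [star_add, add_mul, mul_add, mul_add, hw, hSw', hSw, hSS]; simp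
  · rw [star_add, add_mul, mul_add, mul_add, hw', hwS', hwS, hSS']; simp
  · rw [mul_add, add_mul, hwx, hSx]

end SimilarIsometries

/-! ### C*-convex combinations equal to an isometry. -/

section Contractions

variable {A : Type*} [CStarAlgebra A] [PartialOrder A] [StarOrderedRing A]

theorem norm_le_one_iff_star_mul_self_le_one {a : A} : ‖a‖ ≤ 1 ↔ star a * a ≤ 1 := by
  rw [← CStarAlgebra.norm_le_one_iff_of_nonneg _ (star_mul_self_nonneg a),
    CStarRing.norm_star_mul_self]
  constructor <;> intro h <;> nlinarith [norm_nonneg a]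

theorem norm_mul_add_one_sub_le_one {p a : A} (hp : IsStarProjection p) (hpa : Commute p a)
    (ha : ‖a‖ ≤ 1) : ‖p * a + (1 - p)‖ ≤ 1 := by
  have hpp : p * p = p := hp.isIdempotentElem
  have hps : star p = p := hp.isSelfAdjoint
  have hpa' : star a * p = p * star a := by simpa [hps] using congr(star $(hpa.eq))
  rw [norm_le_one_iff_star_mul_self_le_one] at ha ⊢
  have h := star_left_conjugate_le_conjugate ha p
  rw [hps, mul_one, hpp] at h
  have e : p * (star a * a) * p = star a * p * a := by
    calc p * (star a * a) * p = (p * star a) * (a * p) := by noncomm_ring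
      _ = star a * (p * p) * a := by rw [← hpa', ← hpa.eq]; noncomm_ring
      _ = _ := by rw [hpp]
  calc star (p * a + (1 - p)) * (p * a + (1 - p))
      = star a * (p * p) * a + (star a * p - star a * (p * p)) + (p * a - (p * p) * a)
          + (1 - p - p + p * p) := by
        simp only [star_add, star_sub, star_mul, star_one, hps]; noncomm_ring
    _ = p * (star a * a) * p + (1 - p) := by
        rw [e, hpp, sub_self, sub_self]
        noncomm_ring
    _ ≤ p + (1 - p) := by gcongr
    _ = 1 := by abel

/-- If an isometry is a C*-convex combination of contractions with invertible coefficients, then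
each of these contractions is an isometry, and the coefficients intertwine. -/
theorem isometry_of_isProperCStarConvexCombination {k : ℕ} {x : A} {a t : Fin k → A}
    (hx : star x * x = 1) (ha : ∀ i, ‖a i‖ ≤ 1) (h : IsProperCStarConvexCombination x a t)
    (i : Fin k) : a i * t i = t i * x ∧ star (a i) * a i = 1 := by
  obtain ⟨hu, hsum, hcomb⟩ := h
  set D : Fin k → A := fun i ↦ a i * t i - t i * x
  set E : Fin k → A := fun i ↦ star (t i) * (1 - star (a i) * a i) * t i
  have hcomb' : star x = ∑ i, star (t i) * star (a i) * t i := by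
    rw [hcomb, star_sum]
    exact Finset.sum_congr rfl fun i _ ↦ by simp [mul_assoc]
  have hE : ∀ i, 0 ≤ E i := fun i ↦ star_left_conjugate_nonneg
    (sub_nonneg.2 (norm_le_one_iff_star_mul_self_le_one.1 (ha i))) _
  -- Summed over `i`, the right side becomes `1 - x* x - x* x + x* x = 0`.
  have hDE : ∀ i, star (D i) * D i + E i = star (t i) * t i
      - (star (t i) * star (a i) * t i) * x - star x * (star (t i) * a i * t i)
      + star x * (star (t i) * t i) * x := by
    intro i
    simp only [D, E, star_sub, star_mul]
    noncomm_ring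
  have h0 : ∑ i, (star (D i) * D i + E i) = 0 := by
    simp_rw [hDE, Finset.sum_add_distrib, Finset.sum_sub_distrib, ← Finset.mul_sum,
      ← Finset.sum_mul, ← Finset.mul_sum, hsum, ← hcomb, ← hcomb']
    simp [hx]
  have h1 := (Finset.sum_eq_zero_iff_of_nonneg
    fun i _ ↦ add_nonneg (star_mul_self_nonneg (D i)) (hE i)).1 h0 i (Finset.mem_univ i)
  obtain ⟨hD, hEi⟩ := (add_eq_zero_iff_of_nonneg (star_mul_self_nonneg (D i)) (hE i)).1 h1
  refine ⟨sub_eq_zero.1 ((CStarRing.star_mul_self_eq_zero_iff _).1 hD), ?_⟩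
  have h2 : star (t i) * (1 - star (a i) * a i) = 0 := (hu i).mul_left_eq_zero.1 hEi
  exact (sub_eq_zero.1 ((hu i).star.mul_right_eq_zero.1 h2)).symm

end Contractions

/-! ### Sufficiency: gluing the isometric and coisometric corners. -/

section Sufficiency

variable {H : Type*} [NormedAddCommGroup H] [InnerProductSpace ℂ H] [CompleteSpace H]
  {M : VonNeumannAlgebra H}

namespace VonNeumannAlgebra

theorem mem_closedBall_iff {a : M} : a ∈ Metric.closedBall (0 : M) 1 ↔ ‖(a : H →L[ℂ] H)‖ ≤ 1 := by
  rw [mem_closedBall_zero_iff]; rfl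

theorem _root_.IsProperCStarConvexCombination.coe {k : ℕ} {x : M} {a t : Fin k → M}
    (h : IsProperCStarConvexCombination x a t) :
    IsProperCStarConvexCombination (x : H →L[ℂ] H) (fun i ↦ (a i : H →L[ℂ] H))
      (fun i ↦ (t i : H →L[ℂ] H)) := by
  obtain ⟨hu, hsum, hcomb⟩ := h
  refine ⟨fun i ↦ (hu i).map (SubringClass.subtype M), ?_, ?_⟩
  · simpa using congr(SubringClass.subtype M $hsum)
  · simpa using congr(SubringClass.subtype M $hcomb)

theorem exists_unitary_of_isometry {k : ℕ} {x : M} {a t : Fin k → M} (hx : star x * x = 1)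
    (ha : ∀ i, a i ∈ Metric.closedBall (0 : M) 1) (h : IsProperCStarConvexCombination x a t)
    (i : Fin k) : ∃ u ∈ unitary M, a i = star u * x * u := by
  have hx' : star (x : H →L[ℂ] H) * x = 1 := congr(($hx : H →L[ℂ] H))
  obtain ⟨h1, h2⟩ := isometry_of_isProperCStarConvexCombination hx'
    (fun i ↦ mem_closedBall_iff.1 (ha i)) h.coe i
  obtain ⟨s, hs⟩ := h.1 i
  have hs1 : (t i : H →L[ℂ] H) * (↑s⁻¹ : M) = 1 := by
    rw [← hs]; exact congr(($(s.mul_inv) : H →L[ℂ] H))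
  have hs2 : ((↑s⁻¹ : M) : H →L[ℂ] H) * t i = 1 := by
    rw [← hs]; exact congr(($(s.inv_mul) : H →L[ℂ] H))
  obtain ⟨u, huM, hu1, hu2, hu3⟩ := M.exists_unitary_of_similar_isometries x.2 (a i).2 (t i).2
    hx' h2 hs1 hs2 h1
  refine ⟨star ⟨u, huM⟩, Unitary.star_mem (Unitary.mem_iff.2
    ⟨Subtype.ext hu1, Subtype.ext hu2⟩), Subtype.ext ?_⟩
  rw [star_star]
  change (a i : H →L[ℂ] H) = u * x * star u
  rw [← hu3, mul_assoc, hu2, mul_one]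

theorem exists_unitary_of_coisometry {k : ℕ} {x : M} {a t : Fin k → M} (hx : x * star x = 1)
    (ha : ∀ i, a i ∈ Metric.closedBall (0 : M) 1) (h : IsProperCStarConvexCombination x a t)
    (i : Fin k) : ∃ u ∈ unitary M, a i = star u * x * u := by
  obtain ⟨u, hu, h1⟩ := exists_unitary_of_isometry (x := star x) (a := fun i ↦ star (a i)) (t := t)
    (by rwa [star_star]) (fun i ↦ mem_closedBall_iff.2 (by
      simpa using mem_closedBall_iff.1 (ha i)))
    ⟨h.1, h.2.1, by
      rw [h.2.2, star_sum]; exact Finset.sum_congr rfl fun i _ ↦ by simp [mul_assoc]⟩ i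
  exact ⟨u, hu, by simpa [mul_assoc] using congr(star $h1)⟩

theorem mul_add_one_sub_mem_closedBall {p a : M} (hp : IsCentralProjection p)
    (ha : a ∈ Metric.closedBall (0 : M) 1) :
    p * a + (1 - p) ∈ Metric.closedBall (0 : M) 1 := by
  rw [mem_closedBall_iff] at ha ⊢
  refine norm_mul_add_one_sub_le_one (p := (p : H →L[ℂ] H)) ⟨?_, ?_⟩ ?_ ha
  · exact congr(($(hp.1.isIdempotentElem.eq) : H →L[ℂ] H))
  · exact congr(($(hp.1.isSelfAdjoint.star_eq) : H →L[ℂ] H))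
  · exact congr(($((Set.mem_center_iff.1 hp.2).comm a) : H →L[ℂ] H))

end VonNeumannAlgebra

section Central

variable {A : Type*} [NormedRing A] [StarRing A] {p x : A}

theorem IsCentralProjection.commute (hp : IsCentralProjection p) (a : A) : p * a = a * p :=
  (Set.mem_center_iff.1 hp.2).comm a

theorem IsCentralProjection.one_sub (hp : IsCentralProjection p) :
    IsCentralProjection (1 - p) :=
  ⟨hp.1.one_sub, (Subring.center A).sub_mem (Subring.center A).one_mem hp.2⟩

theorem IsCentralProjection.star_mul_self (hp : IsCentralProjection p)
    (hx : p * (star x * x) = p) : star (p * x + (1 - p)) * (p * x + (1 - p)) = 1 := by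
  have hpp : p * p = p := hp.1.isIdempotentElem
  have hps : star p = p := hp.1.isSelfAdjoint
  have h1 : p * (1 - p) = 0 := by rw [mul_sub, hpp, mul_one, sub_self]
  have h2 : (1 - p) * p = 0 := by rw [sub_mul, hpp, one_mul, sub_self]
  calc star (p * x + (1 - p)) * (p * x + (1 - p))
      = star x * (p * p) * x + star x * (p * (1 - p)) + (1 - p) * p * x + (1 - p) * (1 - p) := by
        simp only [star_add, star_sub, star_mul, star_one, hps]; noncomm_ring
    _ = p * (star x * x) + (1 - p) := by
        rw [h1, h2, hpp, ← hp.commute, sub_mul 1 p, h1]; noncomm_ring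
    _ = 1 := by rw [hx]; abel

/-- The padding `1 - p` is reproduced because it commutes with the `t i` and `∑ tᵢ* tᵢ = 1`; corners
can thus be treated inside the whole algebra with the same coefficients. -/
theorem IsProperCStarConvexCombination.mul_add_one_sub {k : ℕ} {a t : Fin k → A}
    (hp : IsCentralProjection p) (h : IsProperCStarConvexCombination x a t) :
    IsProperCStarConvexCombination (p * x + (1 - p)) (fun i ↦ p * a i + (1 - p)) t := by
  refine ⟨h.1, h.2.1, ?_⟩
  have h1 : ∀ i, star (t i) * (p * a i + (1 - p)) * t i
      = p * (star (t i) * a i * t i) + (1 - p) * (star (t i) * t i) := by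
    intro i
    rw [mul_add, add_mul, ← mul_assoc _ p, ← hp.commute, ← hp.one_sub.commute]
    noncomm_ring
  simp_rw [h1, Finset.sum_add_distrib, ← Finset.mul_sum, h.2.1, ← h.2.2, mul_one]

end Central

theorem isCStarExtremePoint_of_isCentralProjection {x p : M}
    (hx : x ∈ Metric.closedBall (0 : M) 1) (hp : IsCentralProjection p)
    (h1 : p * (star x * x) = p) (h2 : (1 - p) * (x * star x) = 1 - p) :
    IsCStarExtremePoint x := by
  refine ⟨hx, fun k a t ha h i ↦ ?_⟩
  have hpp : p * p = p := hp.1.isIdempotentElem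
  have hps : star p = p := hp.1.isSelfAdjoint
  have hq := hp.one_sub
  have hqq : (1 - p) * (1 - p) = 1 - p := hq.1.isIdempotentElem
  have hpq : p * (1 - p) = 0 := by rw [mul_sub, hpp, mul_one, sub_self]
  have hqp : (1 - p) * p = 0 := by rw [sub_mul, hpp, one_mul, sub_self]
  obtain ⟨u, hu, hau⟩ := VonNeumannAlgebra.exists_unitary_of_isometry (hp.star_mul_self h1)
    (fun i ↦ VonNeumannAlgebra.mul_add_one_sub_mem_closedBall hp (ha i)) (h.mul_add_one_sub hp) i
  have hco : ((1 - p) * x + (1 - (1 - p))) * star ((1 - p) * x + (1 - (1 - p))) = 1 := by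
    have := hq.star_mul_self (x := star x) (by rwa [star_star])
    simpa [hps, ← hp.commute, mul_sub, sub_mul] using this
  obtain ⟨w, hw, haw⟩ := VonNeumannAlgebra.exists_unitary_of_coisometry hco
    (fun i ↦ VonNeumannAlgebra.mul_add_one_sub_mem_closedBall hq (ha i)) (h.mul_add_one_sub hq) i
  obtain ⟨hu1, hu2⟩ := Unitary.mem_iff.1 hu
  obtain ⟨hw1, hw2⟩ := Unitary.mem_iff.1 hw
  have glue : ∀ a b c d : M, (p * a + (1 - p) * b) * (p * c + (1 - p) * d)
      = p * (a * c) + (1 - p) * (b * d) := by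
    intro a b c d
    calc _ = p * (a * p) * c + p * (a * (1 - p)) * d + (1 - p) * (b * p) * c
          + (1 - p) * (b * (1 - p)) * d := by noncomm_ring
      _ = (p * p) * a * c + p * (1 - p) * a * d + (1 - p) * p * b * c
          + (1 - p) * (1 - p) * b * d := by
          rw [← hp.commute, ← hp.commute, ← hq.commute, ← hq.commute]; noncomm_ring
      _ = _ := by rw [hpp, hpq, hqp, hqq]; noncomm_ring
  have hst : star (p * u + (1 - p) * w) = p * star u + (1 - p) * star w := by
    rw [star_add, star_mul, star_mul, star_sub, star_one, hps, hp.commute, hq.commute]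
  refine ⟨p * u + (1 - p) * w, Unitary.mem_iff.2 ⟨?_, ?_⟩, ?_⟩
  · rw [hst, glue, hu1, hw1]; noncomm_ring
  · rw [hst, glue, hu2, hw2]; noncomm_ring
  · have e1 : p * a i = p * (star u * x * u) := by
      calc p * a i = (p * p) * a i + p * (1 - p) := by rw [hpp, hpq, add_zero]
        _ = p * (p * a i + (1 - p)) := by noncomm_ring
        _ = p * (star u * (p * x + (1 - p)) * u) := by rw [hau]
        _ = (p * star u) * (p * x + (1 - p)) * u := by noncomm_ring
        _ = star u * (p * p * x + p * (1 - p)) * u := by rw [hp.commute]; noncomm_ring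
        _ = (star u * p) * x * u := by rw [hpp, hpq]; noncomm_ring
        _ = _ := by rw [← hp.commute]; noncomm_ring
    have e2 : (1 - p) * a i = (1 - p) * (star w * x * w) := by
      calc (1 - p) * a i = (1 - p) * (1 - p) * a i + (1 - p) * (1 - (1 - p)) := by
            rw [hqq, sub_sub_cancel, hqp, add_zero]
        _ = (1 - p) * ((1 - p) * a i + (1 - (1 - p))) := by noncomm_ring
        _ = (1 - p) * (star w * ((1 - p) * x + (1 - (1 - p))) * w) := by rw [haw]
        _ = ((1 - p) * star w) * ((1 - p) * x + (1 - (1 - p))) * w := by noncomm_ring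
        _ = star w * ((1 - p) * (1 - p) * x + (1 - p) * p) * w := by
            rw [hq.commute]; noncomm_ring
        _ = (star w * (1 - p)) * x * w := by rw [hqq, hqp]; noncomm_ring
        _ = _ := by rw [← hq.commute]; noncomm_ring
    calc a i = p * a i + (1 - p) * a i := by noncomm_ring
      _ = (p * star u + (1 - p) * star w) * (p * x + (1 - p) * x) * (p * u + (1 - p) * w) := by
        rw [glue, glue, e1, e2]
      _ = _ := by rw [hst]; congr 2; noncomm_ring

end Sufficiency

/-! ### Weak operator compactness and extreme solutions. -/

section UnitBallCompact

open Filter Topology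

variable {H : Type*} [NormedAddCommGroup H] [InnerProductSpace ℂ H] [CompleteSpace H]

/-- The sesquilinear form `(h, g) ↦ ⟪a h, g⟫` of an operator, as a bare function: the product
topology then induces the weak operator topology. -/
noncomputable def formOf (a : H →L[ℂ] H) : H → H → ℂ := fun h g ↦ inner ℂ (a h) g

omit [CompleteSpace H] in
theorem formOf_injective : Function.Injective (formOf (H := H)) := fun _ _ hab ↦
  ContinuousLinearMap.ext fun h ↦ ext_inner_right ℂ fun g ↦ congrFun (congrFun hab h) g

omit [CompleteSpace H] in
theorem formOf_half_add_half (a b : H →L[ℂ] H) :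
    formOf a = (2⁻¹ : ℝ) • formOf (a + b) + (2⁻¹ : ℝ) • formOf (a - b) := by
  ext h g
  simp [formOf]
  ring

namespace VonNeumannAlgebra

theorem mem_iff_formOf {M : VonNeumannAlgebra H} {a : H →L[ℂ] H} :
    a ∈ M ↔ ∀ s ∈ M.commutant, ∀ h g, formOf a (s h) g = formOf a h (star s g) := by
  constructor
  · intro ha s hs h g
    have h1 : a (s h) = s (a h) := congr($((commute_of_mem hs ha).eq.symm) h)
    simp only [formOf]
    rw [h1, ContinuousLinearMap.star_eq_adjoint, ContinuousLinearMap.adjoint_inner_right]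
  · refine fun h ↦ mem_of_forall_commute fun s hs ↦ ContinuousLinearMap.ext fun k ↦
      ext_inner_right ℂ fun g ↦ ?_
    have := h s hs k g
    simp only [formOf, ContinuousLinearMap.star_eq_adjoint,
      ContinuousLinearMap.adjoint_inner_right] at this
    exact this.symm

/-- Tychonoff: the forms lie in a product of discs, and boundedness, sesquilinearity and the
commutant relations are closed conditions on coordinates. -/
theorem isCompact_formOf_unitBall (M : VonNeumannAlgebra H) :
    IsCompact {B : H → H → ℂ | ∃ a ∈ M, ‖a‖ ≤ 1 ∧ formOf a = B} := by
  have hK : IsCompact (Set.univ.pi fun h : H ↦ Set.univ.pi fun g : H ↦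
      Metric.closedBall (0 : ℂ) (‖h‖ * ‖g‖)) :=
    isCompact_univ_pi fun h ↦ isCompact_univ_pi fun g ↦ isCompact_closedBall _ _
  have hev : ∀ h g : H, Continuous fun B : H → H → ℂ ↦ B h g := fun h g ↦ by fun_prop
  refine hK.of_isClosed_subset (?_ : IsClosed _) ?_
  · have hset : {B : H → H → ℂ | ∃ a ∈ M, ‖a‖ ≤ 1 ∧ formOf a = B} =
        {B | ∀ h g, ‖B h g‖ ≤ ‖h‖ * ‖g‖} ∩ {B | ∀ h k g, B (h + k) g = B h g + B k g} ∩
        {B | ∀ (c : ℂ) (h g : H), B (c • h) g = star c * B h g} ∩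
        {B | ∀ h g k, B h (g + k) = B h g + B h k} ∩
        {B | ∀ (c : ℂ) (h g : H), B h (c • g) = c * B h g} ∩
        {B | ∀ s ∈ M.commutant, ∀ h g, B (s h) g = B h (star s g)} := by
      ext B
      constructor
      · rintro ⟨a, ha, ha1, rfl⟩
        refine ⟨⟨⟨⟨⟨fun h g ↦ ?_, fun h k g ↦ ?_⟩, fun c h g ↦ ?_⟩, fun h g k ↦ ?_⟩,
          fun c h g ↦ ?_⟩, mem_iff_formOf.1 ha⟩
        · refine (norm_inner_le_norm _ _).trans ?_
          gcongr
          simpa using a.le_of_opNorm_le ha1 h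
        · simp [formOf]
        · simp [formOf, mul_comm]
        · simp [formOf]
        · simp [formOf]
      · rintro ⟨⟨⟨⟨⟨h1, h2⟩, h3⟩, h4⟩, h5⟩, h6⟩
        let B' : H →L⋆[ℂ] H →L[ℂ] ℂ := LinearMap.mkContinuous₂
          (LinearMap.mk₂'ₛₗ (starRingEnd ℂ) (RingHom.id ℂ) B h2 h3 h4 h5) 1
          (fun h g ↦ by simpa using h1 h g)
        have hB : formOf (InnerProductSpace.continuousLinearMapOfBilin B') = B := by
          ext h g
          exact InnerProductSpace.continuousLinearMapOfBilin_apply B' h g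
        refine ⟨InnerProductSpace.continuousLinearMapOfBilin B', mem_iff_formOf.2 (hB ▸ h6),
          ContinuousLinearMap.opNorm_le_bound _ zero_le_one fun h ↦ ?_, hB⟩
        set a := InnerProductSpace.continuousLinearMapOfBilin B'
        have h7 : ‖a h‖ * ‖a h‖ ≤ ‖h‖ * ‖a h‖ := by
          have := h1 h (a h)
          rw [← hB] at this
          simpa [formOf, ← sq] using this
        rcases (norm_nonneg (a h)).eq_or_lt with h8 | h8
        · rw [← h8]; positivity
        · rw [one_mul]; exact le_of_mul_le_mul_right h7 h8
    rw [hset]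
    refine ((((IsClosed.inter ?_ ?_).inter ?_).inter ?_).inter ?_).inter ?_
    · simp only [Set.ofPred_forall]
      exact isClosed_iInter fun h ↦ isClosed_iInter fun g ↦
        isClosed_le (hev h g).norm continuous_const
    · simp only [Set.ofPred_forall]
      exact isClosed_iInter fun h ↦ isClosed_iInter fun k ↦ isClosed_iInter fun g ↦
        isClosed_eq (hev _ g) ((hev h g).add (hev k g))
    · simp only [Set.ofPred_forall]
      exact isClosed_iInter fun c ↦ isClosed_iInter fun h ↦ isClosed_iInter fun g ↦
        isClosed_eq (hev _ g) (continuous_const.mul (hev h g))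
    · simp only [Set.ofPred_forall]
      exact isClosed_iInter fun h ↦ isClosed_iInter fun k ↦ isClosed_iInter fun g ↦
        isClosed_eq (hev _ _) ((hev _ _).add (hev _ _))
    · simp only [Set.ofPred_forall]
      exact isClosed_iInter fun c ↦ isClosed_iInter fun h ↦ isClosed_iInter fun g ↦
        isClosed_eq (hev _ _) (continuous_const.mul (hev h g))
    · simp only [Set.ofPred_forall]
      exact isClosed_iInter fun s ↦ isClosed_iInter fun _ ↦ isClosed_iInter fun h ↦
        isClosed_iInter fun g ↦ isClosed_eq (hev _ _) (hev _ _)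
  · rintro _ ⟨a, -, ha1, rfl⟩ h - g -
    rw [mem_closedBall_zero_iff]
    refine (norm_inner_le_norm _ _).trans ?_
    gcongr
    simpa using a.le_of_opNorm_le ha1 h

/-- The contractions `y` of `M` with `y * b = x` have an extreme point, if approximate solutions
exist. -/
theorem exists_extreme_solution (M : VonNeumannAlgebra H) {b x : H →L[ℂ] H}
    (happrox : ∀ ε : ℝ, 0 < ε → ∃ v ∈ M, ‖v‖ ≤ 1 ∧ ‖v * b - x‖ ≤ ε) :
    ∃ y ∈ M, ‖y‖ ≤ 1 ∧ y * b = x ∧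
      ∀ d ∈ M, d * b = 0 → ‖y + d‖ ≤ 1 → ‖y - d‖ ≤ 1 → d = 0 := by
  have hK := M.isCompact_formOf_unitBall
  set K := {B : H → H → ℂ | ∃ a ∈ M, ‖a‖ ≤ 1 ∧ formOf a = B} with hKdef
  set F := K ∩ {B | ∀ h g, B (b h) g = inner ℂ (x h) g}
  have hF : IsCompact F := by
    refine hK.inter_right ?_
    simp only [Set.ofPred_forall]
    exact isClosed_iInter fun h ↦ isClosed_iInter fun g ↦ isClosed_eq (by fun_prop)
      continuous_const
  have hmem : ∀ a : H →L[ℂ] H, formOf a ∈ F ↔ a ∈ M ∧ ‖a‖ ≤ 1 ∧ a * b = x := by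
    intro a
    constructor
    · rintro ⟨⟨a', h1, h2, h3⟩, h4⟩
      obtain rfl := formOf_injective h3
      exact ⟨h1, h2, ContinuousLinearMap.ext fun h ↦ ext_inner_right ℂ fun g ↦ h4 h g⟩
    · rintro ⟨h1, h2, h3⟩
      refine ⟨⟨a, h1, h2, rfl⟩, fun h g ↦ ?_⟩
      rw [← h3]; rfl
  have hne : F.Nonempty := by
    -- A weak limit of approximate solutions along a free ultrafilter is an exact solution.
    choose v hvM hv1 hvx using fun n : ℕ ↦ happrox (1 / ((n : ℝ) + 1)) Nat.one_div_pos_of_nat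
    have hu : ((hyperfilter ℕ).map fun n ↦ formOf (v n) : Filter (H → H → ℂ)) ≤ 𝓟 K := by
      rw [le_principal_iff]
      exact Filter.mem_map.2 (Filter.univ_mem' fun n ↦ ⟨v n, hvM n, hv1 n, rfl⟩)
    obtain ⟨B, hBK, hB⟩ := hK.ultrafilter_le_nhds _ hu
    refine ⟨B, hBK, fun h g ↦ ?_⟩
    have hle : (hyperfilter ℕ : Filter ℕ) ≤ atTop :=
      Nat.hyperfilter_le_atTop
    have h1 : Tendsto (fun n ↦ formOf (v n) (b h) g) (hyperfilter ℕ) (𝓝 (B (b h) g)) := by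
      have hc : Continuous fun B : H → H → ℂ ↦ B (b h) g := by fun_prop
      exact (hc.tendsto B).comp hB
    have h2 : Tendsto (fun n ↦ v n * b) atTop (𝓝 x) :=
      tendsto_iff_norm_sub_tendsto_zero.2 <| squeeze_zero (fun _ ↦ norm_nonneg _) hvx
        tendsto_one_div_add_atTop_nhds_zero_nat
    have h3 : Tendsto (fun n ↦ formOf (v n) (b h) g) atTop (𝓝 (inner ℂ (x h) g)) := by
      have hc : Continuous fun a : H →L[ℂ] H ↦ inner ℂ (a h) g := by fun_prop
      exact (hc.tendsto x).comp h2
    exact tendsto_nhds_unique h1 (h3.mono_left hle)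
  -- Krein–Milman; extremality is then tested on `y` as the midpoint of `y + d` and `y - d`.
  obtain ⟨B, hB⟩ := hF.extremePoints_nonempty hne
  obtain ⟨y, -, -, rfl⟩ := hB.1.1
  obtain ⟨hyM, hy1, hyb⟩ := (hmem y).1 hB.1
  refine ⟨y, hyM, hy1, hyb, fun d hd hdb h1 h2 ↦ ?_⟩
  have h3 := (hmem (y + d)).2 ⟨add_mem hyM hd, h1, by rw [add_mul, hdb, hyb, add_zero]⟩
  have h4 := (hmem (y - d)).2 ⟨sub_mem hyM hd, h2, by rw [sub_mul, hdb, hyb, sub_zero]⟩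
  have h5 := ((mem_extremePoints.1 hB).2 _ h3 _ h4
    ⟨2⁻¹, 2⁻¹, by norm_num, by norm_num, by norm_num, (formOf_half_add_half y d).symm⟩).1
  simpa using formOf_injective h5

end VonNeumannAlgebra

end UnitBallCompact

/-! ### Norm estimates for contractions. -/

section ExtremeContractions

variable {A : Type*} [CStarAlgebra A] [PartialOrder A] [StarOrderedRing A]

theorem mul_eq_zero_of_star_mul_mul_eq_zero {k h : A} (hk : 0 ≤ k) (hkh : star h * k * h = 0) :
    k * h = 0 := by
  have hs : star (CFC.sqrt k) = CFC.sqrt k := (CFC.sqrt_nonneg k).isSelfAdjoint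
  have h1 : CFC.sqrt k * h = 0 := by
    rw [← CStarRing.star_mul_self_eq_zero_iff, star_mul, hs, mul_assoc, ← mul_assoc (CFC.sqrt k),
      CFC.sqrt_mul_sqrt_self k, ← mul_assoc, hkh]
  rw [← CFC.sqrt_mul_sqrt_self k, mul_assoc, h1, mul_zero]

/-- `1 - (2h - 1)² = 4 h (1 - h)` is positive. -/
theorem norm_two_smul_sub_one_le {h : A} (h0 : 0 ≤ h) (h1 : ‖h‖ ≤ 1) :
    ‖(2 : ℂ) • h - 1‖ ≤ 1 := by
  have hs : star h = h := h0.isSelfAdjoint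
  rw [norm_le_one_iff_star_mul_self_le_one, ← sub_nonneg]
  have h2 : 0 ≤ h * (1 - h) := Commute.mul_nonneg h0
    (sub_nonneg.2 ((CStarAlgebra.norm_le_one_iff_of_nonneg h).1 h1))
    ((Commute.one_right h).sub_right (Commute.refl h))
  have h3 : 1 - star ((2 : ℂ) • h - 1) * ((2 : ℂ) • h - 1)
      = h * (1 - h) + h * (1 - h) + (h * (1 - h) + h * (1 - h)) := by
    rw [two_smul, star_sub, star_add, hs, star_one]; noncomm_ring
  rw [h3]
  exact add_nonneg (add_nonneg h2 h2) (add_nonneg h2 h2)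

theorem norm_add_le_one_of_star_mul_eq_zero {y d : A} (hyd : star y * d = 0)
    (h : star y * y + star d * d ≤ 1) : ‖y + d‖ ≤ 1 := by
  have hdy : star d * y = 0 := by simpa using congr(star $hyd)
  rw [norm_le_one_iff_star_mul_self_le_one, star_add, add_mul, mul_add, mul_add, hyd, hdy]
  simpa using h

end ExtremeContractions

/-! ### Kadison's condition and central projections. -/

section Kadison

variable {H : Type*} [NormedAddCommGroup H] [InnerProductSpace ℂ H] [CompleteSpace H]

namespace VonNeumannAlgebra

open scoped ComplexOrder

theorem abs_mem {M : VonNeumannAlgebra H} {x : H →L[ℂ] H} (hx : x ∈ M) : CFC.abs x ∈ M :=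
  mem_of_forall_commute fun b hb ↦ by
    have h : Commute (star x * x) b := (commute_of_mem hb (mul_mem (star_mem hx) hx)).symm
    exact (Commute.cfcₙ_nnreal h NNReal.sqrt).symm

/-- Approximate polar decompositions. -/
theorem exists_norm_mul_abs_sub_le (M : VonNeumannAlgebra H) {x : H →L[ℂ] H} (hx : x ∈ M) {ε : ℝ}
    (hε : 0 < ε) : ∃ v ∈ M, ‖v‖ ≤ 1 ∧ ‖v * CFC.abs x - x‖ ≤ ε := by
  have hhM := abs_mem hx
  have hh0 : 0 ≤ CFC.abs x := CFC.abs_nonneg x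
  have hhh : CFC.abs x * CFC.abs x = star x * x := CFC.abs_mul_abs x
  set h := CFC.abs x
  have hε0 : (0 : H →L[ℂ] H) ≤ (ε : ℂ) • 1 := by
    have : (0 : ℂ) ≤ ε := by exact_mod_cast hε.le
    exact smul_nonneg this zero_le_one
  have hg : IsStrictlyPositive (h + (ε : ℂ) • (1 : H →L[ℂ] H)) :=
    IsStrictlyPositive.nonneg_add hh0
      (IsStrictlyPositive.smul (by exact_mod_cast hε) isStrictlyPositive_one)
  obtain ⟨g, hgu⟩ := hg.isUnit
  have hgs : star (g : H →L[ℂ] H) = g := by rw [hgu]; exact hg.nonneg.isSelfAdjoint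
  -- With `k = (|x| + ε)⁻¹` and `v = x k`, one has `1 - v* v = k (2ε|x| + ε²) k` and `v |x| - x = -ε
  -- v`.
  set k : H →L[ℂ] H := ↑g⁻¹ with hk
  have hgk : (g : H →L[ℂ] H) * k = 1 := g.mul_inv
  have hkg : k * g = 1 := g.inv_mul
  have hks : star k = k := by
    have h1 : star k * g = 1 := by simpa [hgs] using congr(star $hgk)
    calc star k = star k * (g * k) := by rw [hgk, mul_one]
      _ = k := by rw [← mul_assoc, h1, one_mul]
  have hkM : k ∈ M := mem_of_forall_commute fun b hb ↦ by
    have h1 : Commute b (g : H →L[ℂ] H) := by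
      rw [hgu]
      exact commute_of_mem hb (add_mem hhM (M.smul_mem _ (one_mem M)))
    exact h1.units_inv_right
  have hxk : ‖x * k‖ ≤ 1 := by
    rw [norm_le_one_iff_star_mul_self_le_one, ← sub_nonneg]
    have h1 : 1 - star (x * k) * (x * k)
        = star k * ((ε : ℂ) • h + (ε : ℂ) • h + (ε : ℂ) • ((ε : ℂ) • 1)) * k := by
      have h2 : (ε : ℂ) • h + (ε : ℂ) • h + (ε : ℂ) • ((ε : ℂ) • 1)
          = (g : H →L[ℂ] H) * g - h * h := by
        rw [hgu]
        simp only [add_mul, mul_add, smul_mul_assoc, mul_smul_comm, one_mul, mul_one, smul_add]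
        abel
      rw [h2, hks, star_mul, hks]
      calc 1 - k * star x * (x * k) = (k * g) * (g * k) - k * (star x * x) * k := by
            rw [hkg, hgk]; noncomm_ring
        _ = _ := by rw [← hhh]; noncomm_ring
    rw [h1]
    have h3 : (0 : ℂ) ≤ ε := by exact_mod_cast hε.le
    exact star_left_conjugate_nonneg (add_nonneg (add_nonneg (smul_nonneg h3 hh0)
      (smul_nonneg h3 hh0)) (smul_nonneg h3 hε0)) _
  refine ⟨x * k, mul_mem hx hkM, hxk, ?_⟩
  have h1 : x * k * h - x = -((ε : ℂ) • (x * k)) := by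
    have h2 : h = g - (ε : ℂ) • 1 := by rw [hgu]; abel
    rw [h2, mul_sub, mul_assoc, hkg, mul_one, mul_smul_comm, mul_one]; abel
  rw [h1, norm_neg, norm_smul]
  simpa [abs_of_pos hε] using mul_le_mul_of_nonneg_left hxk hε.le

/-- Every contraction `x` in a von Neumann algebra is the midpoint of a contraction and of a
partial isometry `y` with `(1 - y y*) M (1 - y* y) = 0`. -/
theorem exists_midpoint_extreme (M : VonNeumannAlgebra H) {x : H →L[ℂ] H} (hx : x ∈ M)
    (hx1 : ‖x‖ ≤ 1) : ∃ y ∈ M, ∃ z ∈ M, ‖y‖ ≤ 1 ∧ ‖z‖ ≤ 1 ∧ y + z = (2 : ℂ) • x ∧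
      ∀ m ∈ M, (1 - y * star y) * m * (1 - star y * y) = 0 := by
  have hhM := abs_mem hx
  have hh0 : 0 ≤ CFC.abs x := CFC.abs_nonneg x
  have hh1 : ‖CFC.abs x‖ ≤ 1 := by rwa [CFC.norm_abs]
  have hhh : CFC.abs x * CFC.abs x = star x * x := CFC.abs_mul_abs x
  obtain ⟨y, hyM, hy1, hyh, hext⟩ := M.exists_extreme_solution
    fun ε hε ↦ M.exists_norm_mul_abs_sub_le hx hε
  set h := CFC.abs x
  have hhs : star h = h := hh0.isSelfAdjoint
  refine ⟨y, hyM, y * ((2 : ℂ) • h - 1), mul_mem hyM (sub_mem (M.smul_mem _ hhM) (one_mem M)),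
    hy1, ?_, ?_, ?_⟩
  · exact (norm_mul_le _ _).trans (mul_le_one₀ hy1 (norm_nonneg _)
      (norm_two_smul_sub_one_le hh0 hh1))
  · rw [mul_sub, mul_smul_comm, hyh, mul_one]; abel
  have hyy : star y * y ≤ 1 := norm_le_one_iff_star_mul_self_le_one.1 hy1
  have hyM' := star_mem hyM
  obtain ⟨k, hk⟩ : ∃ k, k = 1 - star y * y := ⟨_, rfl⟩
  have hkM : k ∈ M := hk ▸ sub_mem (one_mem M) (mul_mem hyM' hyM)
  have hk0 : 0 ≤ k := hk ▸ sub_nonneg.2 hyy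
  have hks : star k = k := hk0.isSelfAdjoint
  have hyyk : star y * y = 1 - k := by rw [hk]; abel
  -- So every multiple `m k` is an admissible perturbation of the equation `y h = x`.
  have hkh : k * h = 0 := by
    refine mul_eq_zero_of_star_mul_mul_eq_zero hk0 ?_
    calc star h * k * h = h * h - star (y * h) * (y * h) := by
          rw [hk, hhs, star_mul, hhs]; noncomm_ring
      _ = 0 := by rw [hyh, hhh, sub_self]
  -- Perturb by `y k / 2`: `(1 - k)(1 + k/2)² = 1 - 3k²/4 - k³/4`, and `1 - k/2 = (1 + y* y)/2`.
  -- Once `y k = 0`, `k` is a projection and `y` a partial isometry.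
  have hyk : y * k = 0 := by
    have h1 := hext ((2⁻¹ : ℂ) • (y * k)) (M.smul_mem _ (mul_mem hyM hkM))
      (by rw [smul_mul_assoc, mul_assoc, hkh, mul_zero, smul_zero]) ?_ ?_
    · simpa using h1
    · rw [norm_le_one_iff_star_mul_self_le_one, ← sub_nonneg]
      have h2 : 1 - star (y + (2⁻¹ : ℂ) • (y * k)) * (y + (2⁻¹ : ℂ) • (y * k))
          = (3 / 4 : ℂ) • (star k * k) + (4⁻¹ : ℂ) • (star k * k * k) := by
        have h3 : y + (2⁻¹ : ℂ) • (y * k) = y * (1 + (2⁻¹ : ℂ) • k) := by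
          rw [mul_add, mul_one, mul_smul_comm]
        rw [h3, star_mul, mul_assoc, ← mul_assoc (star y), hyyk]
        simp only [star_add, star_one, star_smul, hks, mul_add, add_mul, mul_sub, sub_mul,
          smul_mul_assoc, mul_smul_comm, one_mul, mul_one, smul_add, smul_sub, smul_smul,
          RCLike.star_def, map_inv₀, map_ofNat, mul_assoc]
        match_scalars <;> norm_num
      rw [h2]
      refine add_nonneg (smul_nonneg (by norm_num [Complex.le_def]) (star_mul_self_nonneg k))
        (smul_nonneg (by norm_num [Complex.le_def]) ?_)
      have := star_left_conjugate_nonneg hk0 k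
      simpa [hks] using this
    · have h2 : y - (2⁻¹ : ℂ) • (y * k) = y * ((2⁻¹ : ℂ) • (1 + star y * y)) := by
        rw [hyyk]
        simp only [mul_add, mul_sub, mul_one, mul_smul_comm]
        match_scalars <;> norm_num
      rw [h2]
      have h3 : ‖1 + star y * y‖ ≤ 1 + 1 := by
        refine (norm_add_le _ _).trans (add_le_add ?_ ?_)
        · exact ContinuousLinearMap.norm_id_le
        · rw [CStarRing.norm_star_mul_self]; exact mul_le_one₀ hy1 (norm_nonneg _) hy1
      refine (norm_mul_le _ _).trans (mul_le_one₀ hy1 (norm_nonneg _) ?_)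
      rw [norm_smul]; norm_num at h3 ⊢; linarith
  have hkk : k * k = k := by
    calc k * k = (1 - star y * y) * k := by rw [← hk]
      _ = k - star y * (y * k) := by rw [sub_mul, one_mul, mul_assoc]
      _ = k := by rw [hyk, mul_zero, sub_zero]
  have hfy : star y * (1 - y * star y) = 0 := by
    calc star y * (1 - y * star y) = k * star y := by rw [hk]; noncomm_ring
      _ = star (y * k) := by rw [star_mul, hks]
      _ = 0 := by rw [hyk, star_zero]
  have hffs : star (1 - y * star y) = 1 - y * star y := by simp
  have hff : star (1 - y * star y) * (1 - y * star y) ≤ 1 := by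
    have h1 : star (1 - y * star y) * (1 - y * star y) = 1 - y * star y := by
      rw [hffs, sub_mul, mul_assoc, hfy]; simp
    rw [h1]
    exact sub_le_self _ (mul_star_self_nonneg y)
  -- These perturbations have initial and final spaces orthogonal to those of `y`, so adding or
  -- subtracting them keeps a contraction.
  have hcontr : ∀ m ∈ M, ‖m‖ ≤ 1 → (1 - y * star y) * m * k = 0 := by
    intro m hm hm1
    have hd1 : star y * ((1 - y * star y) * m * k) = 0 := by
      rw [← mul_assoc, ← mul_assoc, hfy, zero_mul, zero_mul]
    have hd2 : star y * y + star ((1 - y * star y) * m * k) * ((1 - y * star y) * m * k) ≤ 1 := by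
      have h1 : ‖(1 - y * star y) * m‖ ≤ 1 := (norm_mul_le _ _).trans
        (mul_le_one₀ (norm_le_one_iff_star_mul_self_le_one.2 hff) (norm_nonneg _) hm1)
      have h2 := star_left_conjugate_le_conjugate (norm_le_one_iff_star_mul_self_le_one.1 h1) k
      rw [mul_one, hks, hkk] at h2
      rw [star_mul _ k, hks, hyyk]
      calc _ = 1 - k + k * (star ((1 - y * star y) * m) * ((1 - y * star y) * m)) * k := by
            noncomm_ring
        _ ≤ 1 - k + k := by gcongr
        _ = 1 := by abel
    refine hext _ (mul_mem (mul_mem (sub_mem (one_mem M) (mul_mem hyM hyM')) hm) hkM)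
      (by rw [mul_assoc, hkh, mul_zero]) (norm_add_le_one_of_star_mul_eq_zero hd1 hd2) ?_
    rw [sub_eq_add_neg]
    refine norm_add_le_one_of_star_mul_eq_zero (by rw [mul_neg, hd1, neg_zero]) ?_
    rwa [star_neg, neg_mul_neg]
  intro m hm
  rw [← hk]
  have h1 := hcontr (((‖m‖ + 1 : ℝ) : ℂ)⁻¹ • m) (M.smul_mem _ hm) (by
    have h0 : 0 < ‖m‖ + 1 := by positivity
    rw [norm_smul, norm_inv, Complex.norm_real, Real.norm_of_nonneg h0.le, inv_mul_le_iff₀ h0]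
    linarith)
  rw [mul_smul_comm, smul_mul_assoc, smul_eq_zero] at h1
  refine h1.resolve_left (inv_ne_zero ?_)
  have h0 : ‖m‖ + 1 ≠ 0 := by positivity
  exact_mod_cast h0

/-- If `f M e = 0`, then a central projection `c` of `M` satisfies `c e = e` and `f c = 0`. -/
theorem exists_central_of_forall_mul_mul_eq_zero (M : VonNeumannAlgebra H) {e f : H →L[ℂ] H}
    (he : e ∈ M) (h : ∀ m ∈ M, f * m * e = 0) :
    ∃ c ∈ M, IsStarProjection c ∧ (∀ m ∈ M, c * m = m * c) ∧ c * e = e ∧ f * c = 0 := by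
  -- The closed span of `M e H` is invariant under `M` and its commutant, so its projection is
  -- central; `f` vanishes on it.
  set V : Submodule ℂ H := Submodule.span ℂ {k | ∃ m ∈ M, ∃ g, m (e g) = k}
  set N := V.topologicalClosure
  have hmap : ∀ s : H →L[ℂ] H, (∀ m ∈ M, ∃ m' ∈ M, ∀ g, ∃ g', s (m (e g)) = m' (e g')) →
      ∀ k ∈ N, s k ∈ N := by
    intro s hs
    have hV : ∀ k ∈ V, s k ∈ V := by
      intro k hk
      induction hk using Submodule.span_induction with
      | mem k hk =>
        obtain ⟨m, hm, g, rfl⟩ := hk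
        obtain ⟨m', hm', hg⟩ := hs m hm
        obtain ⟨g', hg'⟩ := hg g
        exact Submodule.subset_span ⟨m', hm', g', hg'.symm⟩
      | zero => simp
      | add k l _ _ hk hl => rw [map_add]; exact V.add_mem hk hl
      | smul c k _ hk => rw [map_smul]; exact V.smul_mem c hk
    intro k hk
    exact map_mem_closure s.continuous hk hV
  have hinvM : ∀ s ∈ M, ∀ k ∈ N, s k ∈ N := fun s hs ↦ hmap s fun m hm ↦
    ⟨s * m, mul_mem hs hm, fun g ↦ ⟨g, rfl⟩⟩
  have hinvM' : ∀ s ∈ M.commutant, ∀ k ∈ N, s k ∈ N := fun s hs ↦ hmap s fun m hm ↦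
    ⟨m, hm, fun g ↦ ⟨s g, congr($((commute_of_mem hs (mul_mem hm he)).eq) g)⟩⟩
  have hc : IsStarProjection N.starProjection := isStarProjection_starProjection
  have hcM : N.starProjection ∈ M := (IsStarProjection.mem_iff hc M).2 fun s hs ↦ by
    rw [Submodule.range_starProjection]; exact hinvM' s hs
  have hcM' : N.starProjection ∈ M.commutant := (IsStarProjection.mem_iff hc _).2 fun s hs ↦ by
    rw [Submodule.range_starProjection]; exact hinvM s (by rwa [commutant_commutant] at hs)
  refine ⟨N.starProjection, hcM, hc, fun m hm ↦ (commute_of_mem hcM' hm).eq, ?_, ?_⟩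
  · refine ContinuousLinearMap.ext fun g ↦ Submodule.starProjection_eq_self_iff.2 ?_
    exact V.le_topologicalClosure (Submodule.subset_span ⟨1, one_mem M, g, rfl⟩)
  · refine ContinuousLinearMap.ext fun g ↦ ?_
    have hker : ∀ k ∈ N, f k = 0 := by
      intro k hk
      have hV : ∀ k ∈ V, f k ∈ ({0} : Set H) := by
        intro k hk
        induction hk using Submodule.span_induction with
        | mem k hk =>
          obtain ⟨m, hm, g, rfl⟩ := hk
          exact congr($(h m hm) g)
        | zero => simp
        | add k l _ _ hk hl =>
          rw [Set.mem_singleton_iff] at hk hl ⊢; rw [map_add, hk, hl, add_zero]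
        | smul c k _ hk => rw [Set.mem_singleton_iff] at hk ⊢; rw [map_smul, hk, smul_zero]
      simpa using map_mem_closure f.continuous hk hV
    exact hker _ (N.starProjection_apply_mem g)

end VonNeumannAlgebra

end Kadison

/-! ### Necessity: transferring Kadison's condition to `x`. -/

section Necessity

variable {H : Type*} [NormedAddCommGroup H] [InnerProductSpace ℂ H] [CompleteSpace H]
  {M : VonNeumannAlgebra H}

open VonNeumannAlgebra in
theorem IsCStarExtremePoint.exists_isCentralProjection {x : M} (h : IsCStarExtremePoint x) :
    ∃ p : M, IsCentralProjection p ∧ p * (star x * x) = p ∧ (1 - p) * (x * star x) = 1 - p := by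
  obtain ⟨y, hyM, z, hzM, hy1, hz1, hyz, hyf⟩ :=
    M.exists_midpoint_extreme x.2 (mem_closedBall_iff.1 h.1)
  obtain ⟨c, hcM, hc, hcomm, hce, hcf⟩ := M.exists_central_of_forall_mul_mul_eq_zero
    (sub_mem (one_mem M) (mul_mem (star_mem hyM) hyM)) hyf
  -- The scalar `1/√2` turns the midpoint into a proper C*-convex combination.
  obtain ⟨s, hs⟩ : ∃ s : ℂ, s = ((√2)⁻¹ : ℝ) := ⟨_, rfl⟩
  have hss : s * s = 2⁻¹ := by
    rw [hs, ← Complex.ofReal_mul, ← mul_inv, Real.mul_self_sqrt zero_le_two]; norm_num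
  have hsbar : star s = s := by rw [hs]; exact Complex.conj_ofReal _
  have hs0 : s ≠ 0 := by rintro rfl; norm_num at hss
  let t : M := ⟨s • 1, M.smul_mem s (one_mem M)⟩
  let t' : M := ⟨s⁻¹ • 1, M.smul_mem s⁻¹ (one_mem M)⟩
  have ht : IsUnit t := ⟨⟨t, t', Subtype.ext (by simp [t, t', hs0]),
    Subtype.ext (by simp [t, t', hs0])⟩, rfl⟩
  have hconv : IsProperCStarConvexCombination x ![⟨y, hyM⟩, ⟨z, hzM⟩] ![t, t] := by
    refine ⟨fun i ↦ by fin_cases i <;> exact ht, Subtype.ext ?_, Subtype.ext ?_⟩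
    · simp [t, smul_smul, hss, ← add_smul, hsbar]
      norm_num
    · have : (2⁻¹ : ℂ) • (y + z) = x := by rw [hyz, smul_smul]; norm_num
      simp [t, smul_smul, hss, hsbar, ← this]
  obtain ⟨u, hu, hyu⟩ := h.2 2 _ _ (fun i ↦ by
    fin_cases i
    · exact mem_closedBall_iff.2 hy1
    · exact mem_closedBall_iff.2 hz1) hconv 0
  obtain ⟨hu1, hu2⟩ := Unitary.mem_iff.1 hu
  set Y : M := ⟨y, hyM⟩
  set C : M := ⟨c, hcM⟩
  replace hyu : Y = star u * x * u := hyu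
  have hC : IsCentralProjection C := by
    refine ⟨⟨Subtype.ext hc.isIdempotentElem, Subtype.ext hc.isSelfAdjoint⟩, ?_⟩
    rw [Semigroup.mem_center_iff]
    exact fun m ↦ Subtype.ext (hcomm m m.2).symm
  have hxY : x = u * Y * star u := by
    rw [hyu]
    calc x = (u * star u) * x * (u * star u) := by rw [hu2, one_mul, mul_one]
      _ = _ := by noncomm_ring
  have h1 : C * (1 - star Y * Y) = 1 - star Y * Y := Subtype.ext hce
  have h2 : (1 - Y * star Y) * C = 0 := Subtype.ext hcf
  have h1' : (1 - C) * (star Y * Y) = 1 - C := by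
    have : (1 - C) * (star Y * Y) = 1 - C + (C * (1 - star Y * Y) - (1 - star Y * Y)) := by
      noncomm_ring
    rw [this, h1, sub_self, add_zero]
  have h2' : C * (Y * star Y) = C := by
    have : (Y * star Y) * C = C - (1 - Y * star Y) * C := by noncomm_ring
    rw [hC.commute, this, h2, sub_zero]
  have conj : ∀ p T : M, IsCentralProjection p → p * T = p → p * (u * T * star u) = p := by
    intro p T hp hT
    calc p * (u * T * star u) = (p * u) * T * star u := by noncomm_ring
      _ = u * (p * T) * star u := by rw [hp.commute]; noncomm_ring
      _ = (u * p) * star u := by rw [hT]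
      _ = p * (u * star u) := by rw [← hp.commute]; noncomm_ring
      _ = p := by rw [hu2, mul_one]
  -- `C` dominates `1 - y* y` and annihilates `1 - y y*`, so `y` is isometric on `1 - C` and
  -- coisometric on `C`.
  refine ⟨1 - C, hC.one_sub, ?_, ?_⟩
  · have : star x * x = u * (star Y * Y) * star u := by
      rw [hxY]
      calc _ = u * star Y * (star u * u) * Y * star u := by
            simp only [star_mul, star_star]; noncomm_ring
        _ = _ := by rw [hu1]; noncomm_ring
    rw [this]
    exact conj _ _ hC.one_sub h1'
  · have : x * star x = u * (Y * star Y) * star u := by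
      rw [hxY]
      calc _ = u * Y * (star u * u) * star Y * star u := by
            simp only [star_mul, star_star]; noncomm_ring
        _ = _ := by rw [hu1]; noncomm_ring
    rw [this, sub_sub_cancel]
    exact conj _ _ hC h2'

end Necessity

/-! ### Regrouping the corners. -/

section CornerDecomposition

variable {A : Type*} [NormedRing A] [StarRing A] {p x : A}

theorem IsCentralProjection.zero : IsCentralProjection (0 : A) :=
  ⟨.zero _, (Subring.center A).zero_mem⟩

theorem IsCentralProjection.star_mul_mul (hp : IsCentralProjection p) :
    star (p * x) * (p * x) = p * (star x * x) := by
  have hpp : p * p = p := hp.1.isIdempotentElem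
  rw [star_mul, hp.1.isSelfAdjoint.star_eq, mul_assoc, ← mul_assoc p, hpp, ← mul_assoc,
    ← hp.commute, mul_assoc]

theorem IsCentralProjection.mul_mul_star (hp : IsCentralProjection p) :
    p * x * star (p * x) = p * (x * star x) := by
  have hpp : p * p = p := hp.1.isIdempotentElem
  rw [star_mul, hp.1.isSelfAdjoint.star_eq, ← hp.commute, mul_assoc, ← mul_assoc x, ← hp.commute,
    ← mul_assoc, ← mul_assoc, hpp, mul_assoc]

/-- Regrouping the central projections: a unitary, an isometric and a coisometric corner amount
to an isometric corner and a complementary coisometric one. -/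
theorem exists_corners_iff (x : A) :
    (∃ p₁ p₂ p₃ : A,
      IsCentralProjection p₁ ∧ IsCentralProjection p₂ ∧ IsCentralProjection p₃ ∧
      p₁ + p₂ + p₃ = 1 ∧
      (p₁ = 0 ∨ IsUnitaryInCorner p₁ (p₁ * x)) ∧
      (p₂ = 0 ∨ (IsIsometryInCorner p₂ (p₂ * x) ∧ ¬ IsUnitaryInCorner p₂ (p₂ * x))) ∧
      (p₃ = 0 ∨ (IsCoisometryInCorner p₃ (p₃ * x) ∧ ¬ IsUnitaryInCorner p₃ (p₃ * x)))) ↔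
    ∃ p : A, IsCentralProjection p ∧ p * (star x * x) = p ∧ (1 - p) * (x * star x) = 1 - p := by
  constructor
  · rintro ⟨p₁, p₂, p₃, hp₁, hp₂, hp₃, hsum, h1, h2, h3⟩
    have e1 : p₁ * (star x * x) = p₁ := by
      rcases h1 with rfl | h1
      · rw [zero_mul]
      · rw [← hp₁.star_mul_mul, h1.2.1]
    have e2 : p₂ * (star x * x) = p₂ := by
      rcases h2 with rfl | h2
      · rw [zero_mul]
      · rw [← hp₂.star_mul_mul, h2.1.2]
    have e3 : p₃ * (x * star x) = p₃ := by
      rcases h3 with rfl | h3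
      · rw [zero_mul]
      · rw [← hp₃.mul_mul_star, h3.1.2]
    have hp : 1 - p₃ = p₁ + p₂ := by rw [← hsum, add_sub_cancel_right]
    refine ⟨1 - p₃, hp₃.one_sub, ?_, by rwa [sub_sub_cancel]⟩
    rw [hp, add_mul, e1, e2]
  · rintro ⟨p, hp, h1, h2⟩
    have hq := hp.one_sub
    have iso : IsIsometryInCorner p (p * x) := ⟨⟨x, rfl⟩, by rw [hp.star_mul_mul, h1]⟩
    have coiso : IsCoisometryInCorner (1 - p) ((1 - p) * x) :=
      ⟨⟨x, rfl⟩, by rw [hq.mul_mul_star, h2]⟩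
    -- Corners that happen to be unitary, including zero ones, must move into `p₁`, since `p₂` and
    -- `p₃` demand non-unitarity.
    by_cases hu : IsUnitaryInCorner p (p * x) <;>
      by_cases hv : IsUnitaryInCorner (1 - p) ((1 - p) * x)
    · refine ⟨1, 0, 0, ?_, .zero, .zero, by simp, .inr ⟨⟨x, rfl⟩, ?_, ?_⟩, .inl rfl, .inl rfl⟩
      · exact ⟨.one _, (Subring.center A).one_mem⟩
      · have := hv.2.1
        rw [hq.star_mul_mul] at this
        rw [one_mul]
        calc star x * x = p * (star x * x) + (1 - p) * (star x * x) := by noncomm_ring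
          _ = 1 := by rw [h1, this]; abel
      · have := hu.2.2
        rw [hp.mul_mul_star] at this
        rw [one_mul]
        calc x * star x = p * (x * star x) + (1 - p) * (x * star x) := by noncomm_ring
          _ = 1 := by rw [h2, this]; abel
    · exact ⟨p, 0, 1 - p, hp, .zero, hq, by abel, .inr hu, .inl rfl, .inr ⟨coiso, hv⟩⟩
    · exact ⟨1 - p, p, 0, hq, hp, .zero, by abel, .inr hv, .inr ⟨iso, hu⟩, .inl rfl⟩
    · exact ⟨0, p, 1 - p, .zero, hp, hq, by abel, .inl rfl, .inr ⟨iso, hu⟩, .inr ⟨coiso, hv⟩⟩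

end CornerDecomposition

theorem theoremA {H : Type*} [NormedAddCommGroup H] [InnerProductSpace ℂ H] [CompleteSpace H]
    (M : VonNeumannAlgebra H) (x : M) (hx : x ∈ Metric.closedBall (0 : M) 1) :
    IsCStarExtremePoint x ↔
      ∃ p₁ p₂ p₃ : M,
        IsCentralProjection p₁ ∧ IsCentralProjection p₂ ∧ IsCentralProjection p₃ ∧
        p₁ + p₂ + p₃ = 1 ∧
        (p₁ = 0 ∨ IsUnitaryInCorner p₁ (p₁ * x)) ∧
        (p₂ = 0 ∨ (IsIsometryInCorner p₂ (p₂ * x) ∧ ¬ IsUnitaryInCorner p₂ (p₂ * x))) ∧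
        (p₃ = 0 ∨ (IsCoisometryInCorner p₃ (p₃ * x) ∧ ¬ IsUnitaryInCorner p₃ (p₃ * x))) := by
  rw [exists_corners_iff]
  exact ⟨fun h ↦ h.exists_isCentralProjection,
    fun ⟨_, hp, h1, h2⟩ ↦ isCStarExtremePoint_of_isCentralProjection hx hp h1 h2⟩
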